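/- Let $(\Omega,\Sigma,\mu)$ be a $\sigma$-finite measure space and let $L_0(\mu)$ be the vector lattice of ($\mu$-a.e. equivalence classes of) real measurable functions on $\Omega$, with the topology of convergence in measure on sets of finite measure. Let $X$ be an order continuous real Banach lattice (i.e. $\lim_\alpha\|x_\alpha\|=0$ for every downward directed family $(x_\alpha)$ in $X$ with $\bigwedge_\alpha x_\alpha=0$) which is represented as a function space on $(\Omega,\Sigma,\mu)$: $X$ is a vector sublattice of $L_0(\mu)$, the inclusion $X\hookrightarrow L_0(\mu)$ is continuous, and $X$ is an ideal in $L_0(\mu)$ containing the characteristic functions of all measurable sets of finite measure. A continuous valuation on $X$ is a map $V:X\to\mathbb R$ such that (1) $V(f)+V(g)=V(f\vee g)+V(f\wedge g)$ for all $f,g\in X$; (2) $V$ is norm continuous; (3) $V(0)=0$. A strong Carathéodory function is a function $K:\mathbb R\times\Omega\to\mathbb R$ such that $K(\lambda,\cdot)$ is measurable for every $\lambda\in\mathbb R$ and $K(\cdot,t)$ is continuous for $\mu$-almost every $t\in\Omega$. (a) For every continuous valuation $V$ on $X$ there is a strong Carathéodory function $K$ such that, for every $f\in X$, the function $t\mapsto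 K(f(t),t)$ is $\mu$-integrable and $$V(f)=\int_\Omega K(f(t),t)\,d\mu(t).$$ (b) Conversely, let $K$ be a strong Carathéodory function such that $t\mapsto K(f(t),t)$ is $\mu$-integrable for every $f\in X$. Then $V(f)=\int_\Omega K(f(t),t)\,d\mu(t)$ defines a function $V:X\to\mathbb R$ that satisfies (1) and (2). It satisfies (3) as well, i.e. it is a continuous valuation, if and only if $\int_\Omega K(0,t)\,d\mu(t)=0$. -/

import Mathlib

open MeasureTheory Filter Topology

/-- A Banach lattice `X` is order continuous: every (nonempty) downward directed set in `X` with
infimum `0` converges to `0` in norm, as a net indexed by itself. The Banach lattice structure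
itself is given by Mathlib's type classes. -/
def IsOrderContinuousNorm (X : Type*) [NormedAddCommGroup X] [Lattice X] : Prop :=
  ∀ D : Set X, D.Nonempty → DirectedOn (fun x y => y ≤ x) D → IsGLB D 0 →
    ∀ ε : ℝ, 0 < ε → ∃ x ∈ D, ∀ y ∈ D, y ≤ x → ‖y‖ < ε

/-- `ι : X → L₀(μ)` represents the Banach lattice `X` as a function space on `(Ω, Σ, μ)`:
it is an injective lattice homomorphism (the formal inclusion), it is continuous for the topology
of convergence in measure on sets of finite measure, and its image is an ideal in `L₀(μ)`
containing the characteristic functions of the sets of finite measure. -/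
structure IsFunctionSpace {Ω : Type*} [MeasurableSpace Ω] (μ : Measure Ω)
    {X : Type*} [NormedAddCommGroup X] [NormedSpace ℝ X] [Lattice X]
    (ι : X →ₗ[ℝ] (Ω →ₘ[μ] ℝ)) : Prop where
  injective : Function.Injective ι
  map_sup : ∀ f g : X, ι (f ⊔ g) = ι f ⊔ ι g
  map_inf : ∀ f g : X, ι (f ⊓ g) = ι f ⊓ ι g
  continuous : ∀ A : Set Ω, MeasurableSet A → μ A < ⊤ → ∀ f : X,
    TendstoInMeasure (μ.restrict A) (fun (g : X) (t : Ω) => (ι g) t) (𝓝 f) (ι f)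
  ideal : ∀ (f : X) (h : Ω →ₘ[μ] ℝ), |h| ≤ |ι f| → ∃ g : X, ι g = h
  indicator : ∀ A : Set Ω, ∀ hA : MeasurableSet A, μ A < ⊤ →
    ∃ f : X, ι f = AEEqFun.mk (A.indicator fun _ => (1 : ℝ))
      (aestronglyMeasurable_const.indicator hA)

/-- A continuous valuation on a Banach lattice `X`. -/
structure IsContinuousValuation {X : Type*} [NormedAddCommGroup X] [Lattice X]
    (V : X → ℝ) : Prop where
  add_eq : ∀ f g : X, V f + V g = V (f ⊔ g) + V (f ⊓ g)
  continuous : Continuous V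
  map_zero : V 0 = 0

/-- A strong Carathéodory function `K : ℝ × Ω → ℝ`, written in curried form. -/
structure IsStrongCaratheodory {Ω : Type*} [MeasurableSpace Ω] (μ : Measure Ω)
    (K : ℝ → Ω → ℝ) : Prop where
  measurable : ∀ l : ℝ, Measurable (K l)
  continuous : ∀ᵐ t ∂μ, Continuous fun l : ℝ => K l t

/-! For (a), order continuity turns pointwise dominated convergence in `X` into norm convergence
(`tendsto_of_dominated`). A valuation vanishing at 0 is orthogonally additive, so for fixed `f` the
set function A ↦ V(1_A f) is a signed measure absolutely continuous with respect to μ; its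
Radon–Nikodym density `h f` depends only on the local values of `f`. On a set D of finite measure
the kernel must therefore be K(q, t) = h(q • 1_D)(t) for rational q.

The crux is `ae_not_oscillatesBy`: for almost every t in D this is uniformly continuous in q on
bounded sets. Otherwise measurable selection yields two dominated sequences of rational-valued
functions with the same pointwise limit whose densities differ by more than ε on a set B of positive
measure. Both integrals over B have the same limit, by continuity of V: a contradiction. Hence K
extends continuously to real parameters, h f = K(f(t), t) follows by rational approximation of f,
and the kernels are glued along a countable cover.

For (b), the valuation identity holds pointwise, since {f(t), g(t)} consists of the max and the min.
For continuity, a norm convergent sequence has a subsequence that is dominated in `X` and converges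
a.e.; an integrable majorant for the composed functions comes from integrability of K along one
cleverly selected element of `X`. -/

namespace IsFunctionSpace

variable {Ω : Type*} [MeasurableSpace Ω] {μ : Measure Ω}
  {X : Type*} [NormedAddCommGroup X] [NormedSpace ℝ X]
  {ι : X →ₗ[ℝ] (Ω →ₘ[μ] ℝ)}

/-! ### Function spaces: pointwise calculus and dominated convergence -/

lemma coe_sub (f g : X) : ∀ᵐ t ∂μ, ι (f - g) t = ι f t - ι g t := by
  rw [map_sub]
  exact AEEqFun.coeFn_sub _ _

lemma coe_add (f g : X) : ∀ᵐ t ∂μ, ι (f + g) t = ι f t + ι g t := by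
  rw [map_add]
  exact AEEqFun.coeFn_add _ _

lemma coe_smul (c : ℝ) (f : X) : ∀ᵐ t ∂μ, ι (c • f) t = c * ι f t := by
  rw [map_smul]
  exact AEEqFun.coeFn_smul _ _

lemma coe_zero : ∀ᵐ t ∂μ, ι 0 t = 0 := by
  rw [map_zero]
  exact AEEqFun.coeFn_zero

variable [Lattice X]

lemma eq_of_ae (hι : IsFunctionSpace μ ι) {f g : X} (h : ∀ᵐ t ∂μ, ι f t = ι g t) : f = g :=
  hι.injective (AEEqFun.ext h)

lemma le_iff (hι : IsFunctionSpace μ ι) {f g : X} : f ≤ g ↔ ∀ᵐ t ∂μ, ι f t ≤ ι g t := by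
  have h1 : f ≤ g ↔ ι f ≤ ι g := by
    rw [← sup_eq_right, ← sup_eq_right (a := ι f), ← hι.map_sup]
    exact hι.injective.eq_iff.symm
  rw [h1, ← AEEqFun.coeFn_le]
  rfl

lemma coe_sup (hι : IsFunctionSpace μ ι) (f g : X) :
    ∀ᵐ t ∂μ, ι (f ⊔ g) t = ι f t ⊔ ι g t := by
  rw [hι.map_sup]
  exact AEEqFun.coeFn_sup _ _

lemma coe_inf (hι : IsFunctionSpace μ ι) (f g : X) :
    ∀ᵐ t ∂μ, ι (f ⊓ g) t = ι f t ⊓ ι g t := by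
  rw [hι.map_inf]
  exact AEEqFun.coeFn_inf _ _

lemma coe_abs (hι : IsFunctionSpace μ ι) (f : X) : ∀ᵐ t ∂μ, ι |f| t = |ι f t| := by
  have h : ι |f| = |ι f| := by
    rw [abs, hι.map_sup, map_neg]
    rfl
  rw [h]
  exact AEEqFun.coeFn_abs _

lemma norm_le_norm [HasSolidNorm X] (hι : IsFunctionSpace μ ι) {f g : X}
    (h : ∀ᵐ t ∂μ, |ι f t| ≤ |ι g t|) : ‖f‖ ≤ ‖g‖ := by
  refine norm_le_norm_of_abs_le_abs (hι.le_iff.2 ?_)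
  filter_upwards [h, hι.coe_abs f, hι.coe_abs g] with t h1 h2 h3
  rwa [h2, h3]

/-- The ideal property, phrased with functions instead of equivalence classes. -/
lemma exists_of_abs_le (hι : IsFunctionSpace μ ι) {h : Ω → ℝ} (hm : AEStronglyMeasurable h μ)
    (F : X) (hF : ∀ᵐ t ∂μ, |h t| ≤ |ι F t|) : ∃ g : X, ∀ᵐ t ∂μ, ι g t = h t := by
  obtain ⟨g, hg⟩ := hι.ideal F (AEEqFun.mk h hm) (by
    rw [← AEEqFun.coeFn_le]
    filter_upwards [AEEqFun.coeFn_abs (AEEqFun.mk h hm), AEEqFun.coeFn_abs (ι F),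
      AEEqFun.coeFn_mk h hm, hF] with t h1 h2 h3 h4
    rw [h1, h2, h3]
    exact h4)
  refine ⟨g, ?_⟩
  rw [hg]
  exact AEEqFun.coeFn_mk h hm

lemma exists_indicator (hι : IsFunctionSpace μ ι) (f : X) {A : Set Ω} (hA : MeasurableSet A) :
    ∃ g : X, ∀ᵐ t ∂μ, ι g t = A.indicator (ι f) t := by
  refine hι.exists_of_abs_le ((ι f).aestronglyMeasurable.indicator hA) f (ae_of_all _ fun t => ?_)
  by_cases ht : t ∈ A <;> simp [ht]

lemma exists_one_indicator (hι : IsFunctionSpace μ ι) {A : Set Ω} (hA : MeasurableSet A)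
    (hμ : μ A < ⊤) : ∃ e : X, ∀ᵐ t ∂μ, ι e t = A.indicator (fun _ => (1 : ℝ)) t := by
  obtain ⟨e, he⟩ := hι.indicator A hA hμ
  refine ⟨e, ?_⟩
  rw [he]
  exact AEEqFun.coeFn_mk _ _

/-- A decreasing sequence with a.e. limit 0 has infimum 0 in `X`, so its range is a directed set to
which order continuity applies. -/
lemma tendsto_zero_of_antitone [IsOrderedAddMonoid X] [HasSolidNorm X]
    (hX : IsOrderContinuousNorm X) (hι : IsFunctionSpace μ ι) {r : ℕ → X} (hr : Antitone r)
    (h0 : ∀ᵐ t ∂μ, Tendsto (fun n => ι (r n) t) atTop (𝓝 0)) :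
    Tendsto (fun n => ‖r n‖) atTop (𝓝 0) := by
  have hanti : ∀ᵐ t ∂μ, Antitone fun n => ι (r n) t := by
    have : ∀ᵐ t ∂μ, ∀ n, ι (r (n + 1)) t ≤ ι (r n) t :=
      ae_all_iff.2 fun n => hι.le_iff.1 (hr n.le_succ)
    filter_upwards [this] with t ht using antitone_nat_of_succ_le ht
  have hnn : ∀ n, 0 ≤ r n := fun n => hι.le_iff.2 (by
    filter_upwards [hanti, h0, coe_zero (ι := ι)] with t h1 h2 h3
    rw [h3]
    exact h1.le_of_tendsto h2 n)
  have hglb : IsGLB (Set.range r) 0 := by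
    refine ⟨?_, fun b hb => hι.le_iff.2 ?_⟩
    · rintro _ ⟨n, rfl⟩
      exact hnn n
    · have : ∀ᵐ t ∂μ, ∀ n, ι b t ≤ ι (r n) t :=
        ae_all_iff.2 fun n => hι.le_iff.1 (hb ⟨n, rfl⟩)
      filter_upwards [this, h0, coe_zero (ι := ι)] with t h1 h2 h3
      rw [h3]
      exact ge_of_tendsto' h2 h1
  rw [Metric.tendsto_atTop]
  intro ε hε
  obtain ⟨_, ⟨N, rfl⟩, hN⟩ := hX (Set.range r) (Set.range_nonempty r) (by
    rintro _ ⟨m, rfl⟩ _ ⟨n, rfl⟩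
    exact ⟨r (max m n), ⟨_, rfl⟩, hr (le_max_left _ _), hr (le_max_right _ _)⟩) hglb ε hε
  refine ⟨N, fun n hn => ?_⟩
  simpa using hN (r n) ⟨n, rfl⟩ (hr hn)

/-- Dominated convergence in an order continuous Banach function space. -/
theorem tendsto_of_dominated [IsOrderedAddMonoid X] [HasSolidNorm X]
    (hX : IsOrderContinuousNorm X) (hι : IsFunctionSpace μ ι) {g : ℕ → X} {f : X} (F : X)
    (hF : ∀ n, ∀ᵐ t ∂μ, |ι (g n) t| ≤ |ι F t|)
    (hg : ∀ᵐ t ∂μ, Tendsto (fun n => ι (g n) t) atTop (𝓝 (ι f t))) :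
    Tendsto g atTop (𝓝 f) := by
  have hF' : ∀ᵐ t ∂μ, ∀ n, |ι (g n) t| ≤ |ι F t| := ae_all_iff.2 hF
  -- The tail suprema are bounded by 2|F|, so they belong to `X` by the ideal property; they
  -- decrease to 0 a.e. and majorize |g n - f|.
  set s : ℕ → Ω → ℝ := fun n t => ⨆ k, |ι (g (n + k)) t - ι f t| with hs
  have hbd : ∀ᵐ t ∂μ, ∀ n, |ι (g n) t - ι f t| ≤ 2 * |ι F t| := by
    filter_upwards [hF', hg] with t h1 h2 n
    have : |ι f t| ≤ |ι F t| := le_of_tendsto' h2.abs h1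
    calc _ ≤ |ι (g n) t| + |ι f t| := abs_sub _ _
      _ ≤ _ := by linarith [h1 n]
  have hsm : ∀ n, AEStronglyMeasurable (s n) μ := fun n =>
    (AEMeasurable.iSup fun k => by
      have h1 := (ι (g (n + k))).aemeasurable
      have h2 := (ι f).aemeasurable
      fun_prop).aestronglyMeasurable
  have hs0 : ∀ n t, 0 ≤ s n t := fun n t => Real.iSup_nonneg fun k => abs_nonneg _
  have hsle : ∀ᵐ t ∂μ, ∀ n, s n t ≤ 2 * |ι F t| := by
    filter_upwards [hbd] with t ht n using ciSup_le fun k => ht _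
  have hex : ∀ n, ∃ r : X, ∀ᵐ t ∂μ, ι r t = s n t := fun n => by
    refine hι.exists_of_abs_le (hsm n) ((2 : ℝ) • F) ?_
    filter_upwards [hsle, coe_smul (2 : ℝ) F] with t h1 h2
    rw [h2, abs_mul, abs_of_nonneg (hs0 n t)]
    simpa using h1 n
  choose r hr using hex
  have hr' : ∀ᵐ t ∂μ, ∀ n, ι (r n) t = s n t := ae_all_iff.2 hr
  have hbdd : ∀ᵐ t ∂μ, ∀ n, BddAbove (Set.range fun k => |ι (g (n + k)) t - ι f t|) := by
    filter_upwards [hbd] with t ht n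
    exact ⟨2 * |ι F t|, by rintro _ ⟨k, rfl⟩; exact ht _⟩
  have hranti : Antitone r := antitone_nat_of_succ_le fun n => hι.le_iff.2 (by
    filter_upwards [hr', hbdd] with t h1 h2
    rw [h1, h1]
    refine ciSup_le fun k => ?_
    have := le_ciSup (h2 n) (k + 1)
    rwa [show n + 1 + k = n + (k + 1) by ring])
  have hlim : ∀ᵐ t ∂μ, Tendsto (fun n => ι (r n) t) atTop (𝓝 0) := by
    filter_upwards [hr', hg] with t h1 h2
    simp only [h1]
    rw [Metric.tendsto_atTop] at h2 ⊢
    intro ε hε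
    obtain ⟨N, hN⟩ := h2 (ε / 2) (half_pos hε)
    refine ⟨N, fun n hn => ?_⟩
    rw [Real.dist_eq, sub_zero, abs_of_nonneg (hs0 n t)]
    refine lt_of_le_of_lt (ciSup_le fun k => ?_) (half_lt_self hε)
    have := hN (n + k) (by omega)
    rw [Real.dist_eq] at this
    exact this.le
  rw [tendsto_iff_norm_sub_tendsto_zero]
  refine squeeze_zero (fun _ => norm_nonneg _) (fun n => ?_)
    (tendsto_zero_of_antitone hX hι hranti hlim)
  refine hι.norm_le_norm ?_
  filter_upwards [hr', hbdd, coe_sub (g n) f] with t h1 h2 h3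
  rw [h1, h3, abs_of_nonneg (hs0 n t)]
  exact le_ciSup (h2 n) 0

end IsFunctionSpace

/-! ### Measurable selection of indices -/

lemma exists_measurable_nat_selection {Ω : Type*} [MeasurableSpace Ω] {p : Ω → ℕ → Prop}
    (hp : ∀ n, MeasurableSet {t | p t n}) :
    ∃ N : Ω → ℕ, Measurable N ∧ ∀ t, (∃ n, p t n) → p t (N t) := by
  classical
  -- The second alternative makes `Nat.find` total: where no index works it returns 0.
  have hex : ∀ t, ∃ n, p t n ∨ ¬∃ m, p t m := fun t => by
    by_cases h : ∃ m, p t m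
    · exact ⟨h.choose, Or.inl h.choose_spec⟩
    · exact ⟨0, Or.inr h⟩
  refine ⟨fun t => Nat.find (hex t), measurable_find hex fun n => ?_, fun t ht => ?_⟩
  · have h : {t | ∃ m, p t m} = ⋃ m, {t | p t m} := by
      ext
      simp
    exact (hp n).union (h ▸ MeasurableSet.iUnion hp).compl
  · exact (Nat.find_spec (hex t)).resolve_right (not_not.2 ht)

/-- Beyond some index all terms are smaller than a fixed nonzero one, so the maximum is over a
finite set. -/
lemma exists_abs_le_of_tendsto_zero {a : ℕ → ℝ} (ha : Tendsto a atTop (𝓝 0)) :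
    ∃ n, ∀ m, |a m| ≤ |a n| := by
  by_cases h : ∀ m, a m = 0
  · exact ⟨0, fun m => by simp [h]⟩
  push Not at h
  obtain ⟨k, hk⟩ := h
  obtain ⟨N, hN⟩ := (Metric.tendsto_atTop.1 ha) |a k| (abs_pos.2 hk)
  obtain ⟨n, -, hn⟩ := (Finset.range (max N (k + 1))).exists_max_image (fun i => |a i|)
    ⟨k, by simp⟩
  refine ⟨n, fun m => ?_⟩
  by_cases hm : m < max N (k + 1)
  · exact hn m (by simpa using hm)
  · refine le_trans ?_ (hn k (by simp))
    have := hN m (by omega)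
    rw [Real.dist_eq, sub_zero] at this
    exact this.le

/-! ### Integral functionals are continuous and satisfy the valuation identity -/

namespace IsFunctionSpace

variable {Ω : Type*} [MeasurableSpace Ω] {μ : Measure Ω}
  {X : Type*} [NormedAddCommGroup X] [NormedSpace ℝ X] [Lattice X]
  {ι : X →ₗ[ℝ] (Ω →ₘ[μ] ℝ)}

theorem integral_comp_add_eq (hι : IsFunctionSpace μ ι) {K : ℝ → Ω → ℝ}
    (hint : ∀ f : X, Integrable (fun t => K (ι f t) t) μ) (f g : X) :
    ∫ t, K (ι f t) t ∂μ + ∫ t, K (ι g t) t ∂μ =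
      ∫ t, K (ι (f ⊔ g) t) t ∂μ + ∫ t, K (ι (f ⊓ g) t) t ∂μ := by
  rw [← integral_add (hint _) (hint _), ← integral_add (hint _) (hint _)]
  refine integral_congr_ae ?_
  filter_upwards [hι.coe_sup f g, hι.coe_inf f g] with t h1 h2
  rw [h1, h2]
  rcases le_total (ι f t) (ι g t) with h | h <;> simp [h, add_comm]

variable [IsOrderedAddMonoid X] [HasSolidNorm X]

/-- A decreasing sequence that tends to zero in norm tends to zero almost everywhere. -/
lemma ae_tendsto_zero_of_antitone (hι : IsFunctionSpace μ ι) {r : ℕ → X} (hr : Antitone r)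
    (h0 : Tendsto r atTop (𝓝 0)) : ∀ᵐ t ∂μ, Tendsto (fun n => ι (r n) t) atTop (𝓝 0) := by
  have hanti : ∀ᵐ t ∂μ, Antitone fun n => ι (r n) t := by
    have : ∀ᵐ t ∂μ, ∀ n, ι (r (n + 1)) t ≤ ι (r n) t :=
      ae_all_iff.2 fun n => hι.le_iff.1 (hr n.le_succ)
    filter_upwards [this] with t ht using antitone_nat_of_succ_le ht
  have hnn : ∀ᵐ t ∂μ, ∀ n, 0 ≤ ι (r n) t := ae_all_iff.2 fun n => by
    filter_upwards [hι.le_iff.1 (hr.le_of_tendsto h0 n), coe_zero (ι := ι)] with t h1 h2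
    rwa [h2] at h1
  have hbdd : ∀ᵐ t ∂μ, BddBelow (Set.range fun n => ι (r n) t) := by
    filter_upwards [hnn] with t ht
    exact ⟨0, by rintro _ ⟨n, rfl⟩; exact ht n⟩
  have hle : ∀ n, ∀ᵐ t ∂μ, |⨅ k, ι (r k) t| ≤ |ι (r n) t| := fun n => by
    filter_upwards [hnn, hbdd] with t h1 h2
    rw [abs_of_nonneg (Real.iInf_nonneg h1), abs_of_nonneg (h1 n)]
    exact ciInf_le h2 n
  -- The pointwise infimum lies in `X` by the ideal property; solidity bounds its norm by every ‖r
  -- n‖, so it is 0.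
  obtain ⟨ρ, hρ⟩ := hι.exists_of_abs_le
    (AEMeasurable.iInf fun n => (ι (r n)).aemeasurable).aestronglyMeasurable (r 0) (hle 0)
  have hρ0 : ρ = 0 := by
    refine norm_le_zero_iff.1 (ge_of_tendsto' (tendsto_norm_zero.comp h0) fun n => ?_)
    refine hι.norm_le_norm ?_
    filter_upwards [hle n, hρ] with t h1 h2
    rwa [h2]
  filter_upwards [hanti, hbdd, hρ, coe_zero (ι := ι)] with t h1 h2 h3 h4
  have := tendsto_atTop_ciInf h1 h2
  rwa [← h3, hρ0, h4] at this

lemma exists_dominated_subseq [CompleteSpace X] (hι : IsFunctionSpace μ ι) {u : ℕ → X} {f : X}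
    (hu : Tendsto u atTop (𝓝 f)) :
    ∃ (φ : ℕ → ℕ) (F : X), (∀ᵐ t ∂μ, ∀ n, |ι (u (φ n)) t| ≤ |ι F t|) ∧
      ∀ᵐ t ∂μ, Tendsto (fun n => ι (u (φ n)) t) atTop (𝓝 (ι f t)) := by
  have hex : ∀ n : ℕ, ∃ k, ‖u k - f‖ < (1 / 2 : ℝ) ^ n := fun n => by
    obtain ⟨N, hN⟩ := Metric.tendsto_atTop.1 hu ((1 / 2 : ℝ) ^ n) (by positivity)
    exact ⟨N, by simpa [dist_eq_norm] using hN N le_rfl⟩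
  choose φ hφ using hex
  set d : ℕ → X := fun n => |u (φ n) - f| with hd
  have hsum : Summable d := by
    refine Summable.of_norm_bounded summable_geometric_two fun n => ?_
    rw [norm_abs_eq_norm]
    exact (hφ n).le
  -- The tails of the absolutely convergent series of the `d n` dominate |u (φ n) - f| and decrease
  -- to 0 in norm, hence a.e.; |f| + R 0 is then a common majorant.
  set R : ℕ → X := fun n => ∑' k, d (k + n) with hR
  have hR0 : Tendsto R atTop (𝓝 0) := tendsto_sum_nat_add d
  have hRsucc : ∀ n, R n = d n + R (n + 1) := fun n => by
    have := ((summable_nat_add_iff n).2 hsum).tsum_eq_zero_add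
    simp only [hR, this, zero_add]
    congr 1
    refine tsum_congr fun k => ?_
    congr 1
    ring
  have hanti : Antitone R := antitone_nat_of_succ_le fun n => by
    rw [hRsucc n]
    exact le_add_of_nonneg_left (abs_nonneg _)
  have hdR : ∀ n, d n ≤ R n := fun n => by
    rw [hRsucc n]
    exact le_add_of_nonneg_right (hanti.le_of_tendsto hR0 _)
  have key : ∀ᵐ t ∂μ, ∀ n, |ι (u (φ n)) t - ι f t| ≤ ι (R n) t := ae_all_iff.2 fun n => by
    filter_upwards [hι.le_iff.1 (hdR n), hι.coe_abs (u (φ n) - f), coe_sub (ι := ι) (u (φ n)) f]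
      with t h1 h2 h3
    rwa [h2, h3] at h1
  have hRle : ∀ᵐ t ∂μ, ∀ n, ι (R n) t ≤ ι (R 0) t :=
    ae_all_iff.2 fun n => hι.le_iff.1 (hanti n.zero_le)
  refine ⟨φ, |f| + R 0, ?_, ?_⟩
  · filter_upwards [key, hRle, coe_add (ι := ι) |f| (R 0), hι.coe_abs f] with t h1 h2 h3 h4 n
    rw [h3, h4]
    refine le_trans ?_ (le_abs_self _)
    have h5 := (h1 n).trans (h2 n)
    have h6 : |ι (u (φ n)) t| ≤ |ι f t| + |ι (u (φ n)) t - ι f t| := by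
      simpa using abs_add_le (ι f t) (ι (u (φ n)) t - ι f t)
    linarith
  · filter_upwards [key, hι.ae_tendsto_zero_of_antitone hanti hR0] with t h1 h2
    rw [tendsto_iff_norm_sub_tendsto_zero]
    exact squeeze_zero (fun _ => norm_nonneg _) h1 h2

/-- No growth bound on K is available, so the majorant is built from the integrability hypothesis
itself, applied to a `g` in `X` that realizes the worst deviation at each point. -/
theorem continuous_integral_comp [CompleteSpace X] (hι : IsFunctionSpace μ ι) {K : ℝ → Ω → ℝ}
    (hK : ∀ᵐ t ∂μ, Continuous fun l : ℝ => K l t)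
    (hint : ∀ f : X, Integrable (fun t => K (ι f t) t) μ) :
    Continuous fun f : X => ∫ t, K (ι f t) t ∂μ := by
  rw [continuous_iff_seqContinuous]
  intro u f hu
  refine tendsto_of_subseq_tendsto fun ns hns => ?_
  obtain ⟨φ, F, hF, hlim⟩ := hι.exists_dominated_subseq (hu.comp hns)
  refine ⟨φ, ?_⟩
  set v : ℕ → X := fun n => u (ns (φ n)) with hv
  set a : ℕ → Ω → ℝ := fun n t => K (ι (v n) t) t - K (ι f t) t with ha
  have hai : ∀ n, Integrable (a n) μ := fun n => (hint _).sub (hint _)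
  set b : ℕ → Ω → ℝ := fun n => (hai n).1.mk (a n) with hb
  have hbm : ∀ n, Measurable (b n) := fun n => (hai n).1.stronglyMeasurable_mk.measurable
  have hba : ∀ᵐ t ∂μ, ∀ n, a n t = b n t := ae_all_iff.2 fun n => (hai n).1.ae_eq_mk
  -- `N t` maximizes |b m t| over m, where the `b m` are measurable versions of the `a m`. The
  -- function t ↦ v_{N(t)}(t) is dominated by F, hence in `X`, and a.e. every |a n| is at most |a (N
  -- t)|.
  obtain ⟨N, hNm, hN⟩ := exists_measurable_nat_selection
    (p := fun t n => ∀ m, |b m t| ≤ |b n t|) fun n => by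
      simp only [Set.ofPred_forall]
      exact MeasurableSet.iInter fun m => measurableSet_le (hbm m).abs (hbm n).abs
  have hlim' : ∀ᵐ t ∂μ, Tendsto (fun n => K (ι (v n) t) t) atTop (𝓝 (K (ι f t) t)) := by
    filter_upwards [hlim, hK] with t h1 h2 using (h2.tendsto _).comp h1
  obtain ⟨g, hg⟩ := hι.exists_of_abs_le (h := fun t => ι (v (N t)) t)
    (by
      have h1 : Measurable fun p : ℕ × Ω => ι (v p.1) p.2 :=
        measurable_from_prod_countable_right fun n => (ι (v n)).measurable
      exact (h1.comp (hNm.prodMk measurable_id)).aestronglyMeasurable) F (by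
      filter_upwards [hF] with t ht using ht _)
  refine tendsto_integral_of_dominated_convergence
    (fun t => |K (ι f t) t| + |K (ι g t) t - K (ι f t) t|) (fun n => (hint _).1)
    ((hint f).abs.add ((hint g).sub (hint f)).abs) (fun n => ?_) hlim'
  filter_upwards [hlim', hba, hg] with t h1 h2 h3
  have h4 : Tendsto (fun n => b n t) atTop (𝓝 0) := by
    have := h1.sub_const (K (ι f t) t)
    rw [sub_self] at this
    exact this.congr fun n => h2 n
  have h5 := hN t (exists_abs_le_of_tendsto_zero h4) n
  rw [← h2, ← h2] at h5
  have h6 : K (ι g t) t - K (ι f t) t = a (N t) t := by rw [h3]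
  rw [h6, Real.norm_eq_abs]
  have h7 : |K (ι (v n) t) t| ≤ |K (ι f t) t| + |a n t| := by
    simpa [ha] using abs_add_le (K (ι f t) t) (a n t)
  exact h7.trans (by gcongr)

end IsFunctionSpace

/-! ### Radon–Nikodym densities of a valuation -/

/-- A.e. limits of densities agree with the density of the setwise limit. -/
lemma ae_eq_of_tendsto_setIntegral {Ω : Type*} [MeasurableSpace Ω] {ν : Measure Ω}
    [IsFiniteMeasure ν] {g : ℕ → Ω → ℝ} {h G : Ω → ℝ} (hg : ∀ n, Measurable (g n))
    (hh : Integrable h ν) (hG : ∀ᵐ t ∂ν, Tendsto (fun n => g n t) atTop (𝓝 (G t)))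
    (hlim : ∀ A, MeasurableSet A →
      Tendsto (fun n => ∫ t in A, g n t ∂ν) atTop (𝓝 (∫ t in A, h t ∂ν))) :
    ∀ᵐ t ∂ν, h t = G t := by
  -- On `E m` the g n are uniformly bounded, so bounded convergence applies; the sets `E m` cover
  -- almost every point because convergent sequences are bounded.
  set E : ℕ → Set Ω := fun m => {t | ∀ n, |g n t| ≤ m} with hE
  have hEm : ∀ m, MeasurableSet (E m) := fun m => by
    simp only [hE, Set.ofPred_forall]
    exact MeasurableSet.iInter fun n => measurableSet_le (hg n).abs measurable_const
  have hGm : AEStronglyMeasurable G ν :=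
    aestronglyMeasurable_of_tendsto_ae atTop (fun n => (hg n).aestronglyMeasurable) hG
  have hGb : ∀ m : ℕ, ∀ᵐ t ∂ν.restrict (E m), ‖G t‖ ≤ m := fun m => by
    rw [ae_restrict_iff' (hEm m)]
    filter_upwards [hG] with t h1 h2
    exact le_of_tendsto' h1.norm h2
  have hloc : ∀ m, ∀ᵐ t ∂ν, t ∈ E m → h t = G t := fun m => by
    rw [← ae_restrict_iff' (hEm m)]
    refine Integrable.ae_eq_of_forall_setIntegral_eq _ _ hh.restrict
      (Integrable.of_bound hGm.restrict m (hGb m)) fun s hs _ => ?_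
    rw [Measure.restrict_restrict hs]
    refine tendsto_nhds_unique (hlim _ (hs.inter (hEm m))) ?_
    refine tendsto_integral_of_dominated_convergence (fun _ => (m : ℝ))
      (fun n => (hg n).aestronglyMeasurable) (integrable_const _) (fun n => ?_)
      (ae_restrict_of_ae hG)
    filter_upwards [ae_restrict_mem (hs.inter (hEm m))] with t ht using ht.2 n
  filter_upwards [hG, ae_all_iff.2 hloc] with t h1 h2
  obtain ⟨C, hC⟩ := h1.abs.bddAbove_range
  obtain ⟨m, hm⟩ := exists_nat_ge C
  exact h2 m fun n => (hC ⟨n, rfl⟩).trans hm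

/-- A family of Radon–Nikodym densities `h f` of the set functions `A ↦ V (1_A f)`. -/
structure IsDensityFamily {Ω : Type*} [MeasurableSpace Ω] {μ : Measure Ω}
    {X : Type*} [NormedAddCommGroup X] [NormedSpace ℝ X]
    (ι : X →ₗ[ℝ] (Ω →ₘ[μ] ℝ)) (V : X → ℝ) (h : X → Ω → ℝ) : Prop where
  measurable : ∀ f, Measurable (h f)
  integrable : ∀ f, Integrable (h f) μ
  eq_setIntegral : ∀ f A, MeasurableSet A → ∀ g, (∀ᵐ t ∂μ, ι g t = A.indicator (ι f) t) →
    V g = ∫ t in A, h f t ∂μ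

lemma IsDensityFamily.eq_integral {Ω : Type*} [MeasurableSpace Ω] {μ : Measure Ω}
    {X : Type*} [NormedAddCommGroup X] [NormedSpace ℝ X]
    {ι : X →ₗ[ℝ] (Ω →ₘ[μ] ℝ)} {V : X → ℝ} {h : X → Ω → ℝ} (hh : IsDensityFamily ι V h) (f : X) :
    V f = ∫ t, h f t ∂μ := by
  rw [hh.eq_setIntegral f Set.univ MeasurableSet.univ f (by simp), setIntegral_univ]

section

variable {Ω : Type*} [MeasurableSpace Ω] {μ : Measure Ω}
  {X : Type*} [NormedAddCommGroup X] [NormedSpace ℝ X] [Lattice X]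
  {ι : X →ₗ[ℝ] (Ω →ₘ[μ] ℝ)} {V : X → ℝ} {h : X → Ω → ℝ}

/-- Valuations on function spaces are orthogonally additive. -/
lemma IsContinuousValuation.add_of_disjoint (hV : IsContinuousValuation V)
    (hι : IsFunctionSpace μ ι) {f g : X} (hfg : ∀ᵐ t ∂μ, ι f t = 0 ∨ ι g t = 0) :
    V (f + g) = V f + V g := by
  -- For disjoint supports, the pairs (f, g) and (f + g, 0) have the same supremum and infimum, so
  -- the valuation identity gives V f + V g = V (f + g) + V 0.
  have h1 : f ⊔ g = (f + g) ⊔ 0 := hι.eq_of_ae (by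
    filter_upwards [hfg, hι.coe_sup f g, hι.coe_sup (f + g) 0,
      IsFunctionSpace.coe_add (ι := ι) f g, IsFunctionSpace.coe_zero (ι := ι)] with t h h1 h2 h3 h4
    rw [h1, h2, h3, h4]
    rcases h with h | h <;> simp [h, sup_comm])
  have h2 : f ⊓ g = (f + g) ⊓ 0 := hι.eq_of_ae (by
    filter_upwards [hfg, hι.coe_inf f g, hι.coe_inf (f + g) 0,
      IsFunctionSpace.coe_add (ι := ι) f g, IsFunctionSpace.coe_zero (ι := ι)] with t h h1 h2 h3 h4
    rw [h1, h2, h3, h4]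
    rcases h with h | h <;> simp [h, inf_comm])
  rw [hV.add_eq f g, h1, h2, ← hV.add_eq, hV.map_zero, add_zero]

namespace IsFunctionSpace

variable [IsOrderedAddMonoid X] [HasSolidNorm X]

/-- Orthogonal additivity makes A ↦ V(1_A f) finitely additive, dominated convergence with majorant
f makes it countably additive, and 1_A f = 0 in `X` for null A gives absolute continuity. -/
theorem exists_density [SigmaFinite μ] (hX : IsOrderContinuousNorm X)
    (hι : IsFunctionSpace μ ι) (hV : IsContinuousValuation V) (f : X) :
    ∃ h : Ω → ℝ, Measurable h ∧ Integrable h μ ∧ ∀ A, MeasurableSet A →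
      ∀ g, (∀ᵐ t ∂μ, ι g t = A.indicator (ι f) t) → V g = ∫ t in A, h t ∂μ := by
  classical
  have hex : ∀ A, ∃ g : X, MeasurableSet A → ∀ᵐ t ∂μ, ι g t = A.indicator (ι f) t := fun A => by
    by_cases hA : MeasurableSet A
    · obtain ⟨g, hg⟩ := hι.exists_indicator f hA
      exact ⟨g, fun _ => hg⟩
    · exact ⟨0, fun h => absurd h hA⟩
  choose r hr using hex
  have hr0 : ∀ A, MeasurableSet A → μ A = 0 → r A = 0 := fun A hA h0 => hι.eq_of_ae (by
    filter_upwards [hr A hA, coe_zero (ι := ι), measure_eq_zero_iff_ae_notMem.1 h0]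
      with t h1 h2 h3
    rw [h1, h2, Set.indicator_of_notMem h3])
  have hunion : ∀ A B, MeasurableSet A → MeasurableSet B → Disjoint A B →
      V (r (A ∪ B)) = V (r A) + V (r B) := fun A B hA hB hAB => by
    have h1 : r (A ∪ B) = r A + r B := hι.eq_of_ae (by
      filter_upwards [hr A hA, hr B hB, hr _ (hA.union hB), coe_add (ι := ι) (r A) (r B)]
        with t h1 h2 h3 h4
      rw [h4, h1, h2, h3, Set.indicator_union_of_disjoint hAB])
    rw [h1]
    refine hV.add_of_disjoint hι ?_
    filter_upwards [hr A hA, hr B hB] with t h1 h2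
    rw [h1, h2]
    by_cases ht : t ∈ A
    · exact Or.inr (Set.indicator_of_notMem (Set.disjoint_left.1 hAB ht) _)
    · exact Or.inl (Set.indicator_of_notMem ht _)
  have hfin : ∀ A : ℕ → Set Ω, (∀ i, MeasurableSet (A i)) → Pairwise (Function.onFun Disjoint A) →
      ∀ s : Finset ℕ, ∑ i ∈ s, V (r (A i)) = V (r (⋃ i ∈ s, A i)) := fun A hA hd s => by
    induction s using Finset.induction_on with
    | empty => simp [hr0 ∅ MeasurableSet.empty measure_empty, hV.map_zero]
    | insert j s hj ih =>
      rw [Finset.sum_insert hj, ih, Finset.set_biUnion_insert,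
        hunion _ _ (hA j) (s.measurableSet_biUnion fun i _ => hA i)]
      refine Set.disjoint_iUnion₂_right.2 fun i hi => hd ?_
      rintro rfl
      exact hj hi
  let s : SignedMeasure Ω :=
    { measureOf' := fun A => if MeasurableSet A then V (r A) else 0
      empty' := by simp [hr0 ∅ MeasurableSet.empty measure_empty, hV.map_zero]
      not_measurable' := fun A hA => by simp [hA]
      m_iUnion' := fun A hA hd => by
        simp only [hA, MeasurableSet.iUnion hA, if_true]
        have h1 : (fun s : Finset ℕ => ∑ i ∈ s, V (r (A i))) =
            fun s : Finset ℕ => V (r (⋃ i ∈ s, A i)) := funext (hfin A hA hd)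
        change Tendsto _ _ _
        rw [SummationFilter.unconditional_filter, h1]
        -- Unordered summation is a limit over the finite subsets of ℕ, a countably generated
        -- filter, so sequences suffice.
        refine (hV.continuous.tendsto _).comp (tendsto_of_seq_tendsto fun S hS => ?_)
        have hSm : ∀ n, MeasurableSet (⋃ i ∈ S n, A i) := fun n =>
          (S n).measurableSet_biUnion fun i _ => hA i
        refine tendsto_of_dominated hX hι f (fun n => ?_) ?_
        · filter_upwards [hr _ (hSm n)] with t ht
          simp only [Function.comp, ht]
          by_cases h : t ∈ ⋃ i ∈ S n, A i
          · rw [Set.indicator_of_mem h]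
          · rw [Set.indicator_of_notMem h]
            simp
        · filter_upwards [ae_all_iff.2 fun n => hr _ (hSm n), hr _ (MeasurableSet.iUnion hA)]
            with t h2 h3
          simp only [Function.comp, h2, h3]
          exact ((tendsto_indicator_biUnion_finset A (ι f) t).mono_right (pure_le_nhds _)).comp
            hS }
  have hs : ∀ A, MeasurableSet A → s A = V (r A) := fun A hA => if_pos hA
  have hac : s ≪ᵥ μ.toENNRealVectorMeasure := fun A hA => by
    by_cases hAm : MeasurableSet A
    · rw [Measure.toENNRealVectorMeasure_apply_measurable hAm] at hA
      rw [hs A hAm, hr0 A hAm hA, hV.map_zero]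
    · exact s.not_measurable hAm
  refine ⟨s.rnDeriv μ, SignedMeasure.measurable_rnDeriv _ _, SignedMeasure.integrable_rnDeriv _ _,
    fun A hA g hg => ?_⟩
  have hgr : g = r A := hι.eq_of_ae (by
    filter_upwards [hg, hr A hA] with t h1 h2
    rw [h1, h2])
  rw [hgr, ← hs A hA, ← withDensityᵥ_apply (SignedMeasure.integrable_rnDeriv _ _) hA,
    (s.absolutelyContinuous_iff_withDensityᵥ_rnDeriv_eq μ).1 hac]

theorem exists_densityFamily [SigmaFinite μ] (hX : IsOrderContinuousNorm X)
    (hι : IsFunctionSpace μ ι) (hV : IsContinuousValuation V) :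
    ∃ h : X → Ω → ℝ, IsDensityFamily ι V h := by
  choose h h1 h2 h3 using hι.exists_density hX hV
  exact ⟨h, h1, h2, h3⟩

end IsFunctionSpace

namespace IsDensityFamily

/-- Densities depend only on local values. -/
lemma ae_eq_of_ae_eq_on (hh : IsDensityFamily ι V h) (hι : IsFunctionSpace μ ι) {f g : X}
    {A : Set Ω} (hA : MeasurableSet A) (hfg : ∀ᵐ t ∂μ, t ∈ A → ι f t = ι g t) :
    ∀ᵐ t ∂μ, t ∈ A → h f t = h g t := by
  rw [← ae_restrict_iff' hA]
  refine Integrable.ae_eq_of_forall_setIntegral_eq _ _ (hh.integrable f).restrict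
    (hh.integrable g).restrict fun s hs _ => ?_
  rw [Measure.restrict_restrict hs]
  obtain ⟨w, hw⟩ := hι.exists_indicator f (hs.inter hA)
  rw [← hh.eq_setIntegral f _ (hs.inter hA) w hw, ← hh.eq_setIntegral g _ (hs.inter hA) w]
  filter_upwards [hw, hfg] with t h1 h2
  rw [h1]
  by_cases ht : t ∈ s ∩ A
  · rw [Set.indicator_of_mem ht, Set.indicator_of_mem ht, h2 ht.2]
  · rw [Set.indicator_of_notMem ht, Set.indicator_of_notMem ht]

lemma tendsto_setIntegral [IsOrderedAddMonoid X] [HasSolidNorm X] (hh : IsDensityFamily ι V h)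
    (hX : IsOrderContinuousNorm X) (hι : IsFunctionSpace μ ι) (hV : Continuous V)
    {u : ℕ → X} {f : X} (F : X) (hF : ∀ n, ∀ᵐ t ∂μ, |ι (u n) t| ≤ |ι F t|)
    (hu : ∀ᵐ t ∂μ, Tendsto (fun n => ι (u n) t) atTop (𝓝 (ι f t)))
    {A : Set Ω} (hA : MeasurableSet A) :
    Tendsto (fun n => ∫ t in A, h (u n) t ∂μ) atTop (𝓝 (∫ t in A, h f t ∂μ)) := by
  choose r hr using fun g => hι.exists_indicator g hA
  simp only [← fun g => hh.eq_setIntegral g A hA (r g) (hr g)]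
  refine (hV.tendsto _).comp (hι.tendsto_of_dominated hX F (fun n => ?_) ?_)
  · filter_upwards [hF n, hr (u n)] with t h1 h2
    rw [h2]
    by_cases ht : t ∈ A <;> simp [ht, h1]
  · filter_upwards [hu, hr f, ae_all_iff.2 fun n => hr (u n)] with t h1 h2 h3
    simp only [h2, h3]
    by_cases ht : t ∈ A <;> simp [ht, h1]

/-- Since q takes countably many values, locality can be applied on each level set, where f is a
constant multiple of e. -/
lemma ae_eq_of_rat (hh : IsDensityFamily ι V h) (hι : IsFunctionSpace μ ι) {D : Set Ω}
    (hD : MeasurableSet D) {e f : X} (he : ∀ᵐ t ∂μ, ι e t = D.indicator (fun _ => (1 : ℝ)) t)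
    {q : Ω → ℚ} (hq : Measurable q) (hf : ∀ᵐ t ∂μ, t ∈ D → ι f t = q t) :
    ∀ᵐ t ∂μ, t ∈ D → h f t = h ((q t : ℝ) • e) t := by
  have hloc : ∀ᵐ t ∂μ, ∀ x : ℚ, t ∈ D ∩ q ⁻¹' {x} → h f t = h ((x : ℝ) • e) t :=
    ae_all_iff.2 fun x => by
      refine hh.ae_eq_of_ae_eq_on hι (hD.inter (hq (measurableSet_singleton x))) ?_
      filter_upwards [hf, he, IsFunctionSpace.coe_smul (ι := ι) (x : ℝ) e] with t h1 h2 h3 ht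
      rw [h1 ht.1, h3, h2, Set.indicator_of_mem ht.1, mul_one, ht.2]
  filter_upwards [hloc] with t ht htD using ht (q t) ⟨htD, rfl⟩

end IsDensityFamily

end

/-! ### Oscillation in the rational parameter and construction of the kernel -/

/-- A bounded real sequence comes arbitrarily close to its upper limit at arbitrarily late times. -/
lemma exists_abs_sub_limsup_lt {x : ℕ → ℝ} {M : ℝ} (hx : ∀ n, |x n| ≤ M) (k : ℕ) {δ : ℝ}
    (hδ : 0 < δ) : ∃ i, k ≤ i ∧ |x i - limsup x atTop| < δ := by
  have hb : IsBoundedUnder (· ≤ ·) atTop x := isBoundedUnder_of ⟨M, fun n => (abs_le.1 (hx n)).2⟩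
  have hb' : IsBoundedUnder (· ≥ ·) atTop x := isBoundedUnder_of ⟨-M, fun n => (abs_le.1 (hx n)).1⟩
  have h1 : ∃ᶠ n in atTop, limsup x atTop - δ < x n :=
    frequently_lt_of_lt_limsup hb'.isCoboundedUnder_le (by linarith)
  have h2 : ∀ᶠ n in atTop, x n < limsup x atTop + δ :=
    eventually_lt_of_limsup_lt (by linarith) hb
  obtain ⟨i, ⟨hi1, hi2⟩, hi3⟩ :=
    ((h1.and_eventually h2).and_eventually (eventually_ge_atTop k)).exists
  exact ⟨i, hi3, abs_lt.2 ⟨by linarith, by linarith⟩⟩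

/-- The oscillation of `φ : ℚ → ℝ` on a bounded set exceeds `ε` at arbitrarily small scales. -/
def OscillatesBy (φ : ℚ → ℝ) (M : ℕ) (ε : ℝ) : Prop :=
  ∀ n : ℕ, ∃ p : ℚ × ℚ, (|(p.1 : ℝ)| ≤ M ∧ |(p.2 : ℝ)| ≤ M) ∧
    |(p.1 : ℝ) - p.2| < 1 / (n + 1) ∧ ε < φ p.1 - φ p.2

/-- Failure of oscillation at every scale is the Cauchy criterion along the rationals near x; the
choice M ≥ |x| + 1 keeps these rationals in the bounded range. -/
lemma exists_tendsto_of_not_oscillatesBy {φ : ℚ → ℝ}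
    (hφ : ∀ M j : ℕ, ¬OscillatesBy φ M (1 / (j + 1))) (x : ℝ) :
    ∃ c, Tendsto φ (comap (fun q : ℚ => (q : ℝ)) (𝓝 x)) (𝓝 c) := by
  have hne : (comap (fun q : ℚ => (q : ℝ)) (𝓝 x)).NeBot :=
    Rat.isDenseEmbedding_coe_real.isDenseInducing.comap_nhds_neBot x
  rw [← cauchy_map_iff_exists_tendsto, Metric.cauchy_iff]
  refine ⟨hne.map _, fun ε hε => ?_⟩
  obtain ⟨j, hj⟩ := exists_nat_one_div_lt hε
  obtain ⟨M, hM⟩ := exists_nat_ge (|x| + 1)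
  have := hφ M j
  simp only [OscillatesBy, not_forall, not_exists, not_and, not_lt] at this
  obtain ⟨n, hn⟩ := this
  have hn0 : (0 : ℝ) < 1 / (n + 1) := Nat.one_div_pos_of_nat
  have hn1 : (1 : ℝ) / (n + 1) ≤ 1 := by
    rw [div_le_one (by positivity)]
    linarith [(Nat.cast_nonneg n : (0 : ℝ) ≤ n)]
  refine ⟨φ '' {q : ℚ | |(q : ℝ) - x| < 1 / (n + 1) / 2}, image_mem_map ?_, ?_⟩
  · exact ⟨Metric.ball x (1 / (n + 1) / 2), Metric.ball_mem_nhds _ (half_pos hn0),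
      fun q hq => by simpa [Real.dist_eq] using hq⟩
  · have hbd : ∀ q : ℚ, |(q : ℝ) - x| < 1 / (n + 1) / 2 → |(q : ℝ)| ≤ M := fun q hq => by
      have : |(q : ℝ)| ≤ |x| + |(q : ℝ) - x| := by simpa using abs_add_le x ((q : ℝ) - x)
      linarith
    have hpq : ∀ p q : ℚ, |(p : ℝ) - x| < 1 / (n + 1) / 2 → |(q : ℝ) - x| < 1 / (n + 1) / 2 →
        φ p - φ q < ε := fun p q hp hq => by
      refine lt_of_le_of_lt (hn (p, q) ⟨hbd p hp, hbd q hq⟩ ?_) hj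
      have : |(p : ℝ) - q| ≤ |(p : ℝ) - x| + |(q : ℝ) - x| := by
        rw [abs_sub_comm (q : ℝ) x]
        exact abs_sub_le _ _ _
      linarith
    rintro _ ⟨p, hp, rfl⟩ _ ⟨q, hq, rfl⟩
    rw [Real.dist_eq, abs_lt]
    exact ⟨by linarith [hpq q p hq hp], hpq p q hp hq⟩

namespace IsDensityFamily

variable {Ω : Type*} [MeasurableSpace Ω] {μ : Measure Ω}
  {X : Type*} [NormedAddCommGroup X] [NormedSpace ℝ X] [Lattice X] [IsOrderedAddMonoid X]
  [HasSolidNorm X] {ι : X →ₗ[ℝ] (Ω →ₘ[μ] ℝ)} {V : X → ℝ} {h : X → Ω → ℝ}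

/-- The densities of the constant functions `q • 1_D` are almost everywhere uniformly continuous in
the rational parameter `q`, on bounded sets. -/
theorem ae_not_oscillatesBy (hh : IsDensityFamily ι V h)
    (hX : IsOrderContinuousNorm X) (hι : IsFunctionSpace μ ι) (hV : Continuous V)
    {D : Set Ω} (hD : MeasurableSet D) (hμD : μ D < ⊤) {e : X}
    (he : ∀ᵐ t ∂μ, ι e t = D.indicator (fun _ => (1 : ℝ)) t) (M : ℕ) {ε : ℝ} (hε : 0 < ε) :
    ∀ᵐ t ∂μ, t ∈ D → ¬OscillatesBy (fun q : ℚ => h ((q : ℝ) • e) t) M ε := by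
  set k : ℚ → Ω → ℝ := fun q => h ((q : ℝ) • e) with hk
  have hkm : ∀ q, Measurable (k q) := fun q => hh.measurable _
  set P : ℕ → Ω → ℚ × ℚ → Prop := fun n t p => (|(p.1 : ℝ)| ≤ M ∧ |(p.2 : ℝ)| ≤ M) ∧
    |(p.1 : ℝ) - p.2| < 1 / (n + 1) ∧ ε < k p.1 t - k p.2 t with hP
  have hPm : ∀ n p, MeasurableSet {t | P n t p} := fun n p =>
    ((MeasurableSet.const _).inter ((MeasurableSet.const _).inter
      (measurableSet_lt measurable_const ((hkm _).sub (hkm _)))))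
  set B : Set Ω := {t | t ∈ D ∧ OscillatesBy (fun q => k q t) M ε} with hB
  have hBm : MeasurableSet B := by
    have : B = D ∩ ⋂ n, ⋃ p, {t | P n t p} := by
      ext t
      simp only [Set.mem_inter_iff, Set.mem_iInter, Set.mem_iUnion]
      rfl
    rw [this]
    exact hD.inter (MeasurableSet.iInter fun n => MeasurableSet.iUnion fun p => hPm n p)
  have hBD : B ⊆ D := fun t ht => ht.1
  suffices hB0 : μ B = 0 by
    filter_upwards [measure_eq_zero_iff_ae_notMem.1 hB0] with t ht htD hosc using ht ⟨htD, hosc⟩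
  obtain ⟨E, hE⟩ := exists_surjective_nat (ℚ × ℚ)
  choose N hNm hN using fun n => exists_measurable_nat_selection (p := fun t i => P n t (E i))
    fun i => hPm n (E i)
  set p : ℕ → Ω → ℚ × ℚ := fun n t => E (N n t) with hp
  have hpm : ∀ n, Measurable (p n) := fun n => measurable_from_top.comp (hNm n)
  have hpB : ∀ n, ∀ t ∈ B, P n t (p n t) := fun n t ht => hN n t (by
    obtain ⟨q, hq⟩ := ht.2 n
    obtain ⟨i, rfl⟩ := hE q
    exact ⟨i, hq⟩)
  -- On B the first coordinates are bounded by M, so their upper limit is a measurably chosen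
  -- cluster point.
  set ℓ : Ω → ℝ := fun t => limsup (fun n => ((p n t).1 : ℝ)) atTop with hℓ
  have hcm : ∀ n, Measurable fun t => ((p n t).1 : ℝ) := fun n =>
    measurable_from_top.comp (measurable_fst.comp (hpm n))
  have hℓm : Measurable ℓ := Measurable.limsup hcm
  -- A subsequence index depending measurably on t. The requirement n ≤ i keeps the gap between the
  -- two rationals below 1/(n+1), so both coordinates tend to ℓ.
  choose J hJm hJ using fun n : ℕ => exists_measurable_nat_selection
    (p := fun t i => n ≤ i ∧ |((p i t).1 : ℝ) - ℓ t| < 1 / (n + 1)) fun i =>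
      (MeasurableSet.const _).inter
        (measurableSet_lt ((hcm i).sub hℓm).abs measurable_const)
  have hJB : ∀ n, ∀ t ∈ B, n ≤ J n t ∧ |((p (J n t) t).1 : ℝ) - ℓ t| < 1 / (n + 1) :=
    fun n t ht => hJ n t (exists_abs_sub_limsup_lt (fun m => (hpB m t ht).1.1) n
      Nat.one_div_pos_of_nat)
  have hrm : ∀ n, Measurable fun t => p (J n t) t := fun n => by
    have h1 : Measurable fun s : ℕ × Ω => p s.1 s.2 :=
      measurable_from_prod_countable_right hpm
    exact h1.comp ((hJm n).prodMk measurable_id)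
  set r : ℕ → Ω → ℚ × ℚ := fun n t => p (J n t) t with hr
  have hr1 : ∀ t ∈ B, Tendsto (fun n => ((r n t).1 : ℝ)) atTop (𝓝 (ℓ t)) := fun t ht => by
    rw [tendsto_iff_norm_sub_tendsto_zero]
    exact squeeze_zero (fun _ => norm_nonneg _) (fun n => (hJB n t ht).2.le)
      tendsto_one_div_add_atTop_nhds_zero_nat
  have hr2 : ∀ t ∈ B, Tendsto (fun n => ((r n t).2 : ℝ)) atTop (𝓝 (ℓ t)) := fun t ht => by
    have h1 : Tendsto (fun n => ((r n t).1 : ℝ) - (r n t).2) atTop (𝓝 0) := by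
      refine squeeze_zero_norm (fun n => ?_) tendsto_one_div_add_atTop_nhds_zero_nat
      refine ((hpB (J n t) t ht).2.1.le).trans ?_
      exact Nat.one_div_le_one_div (hJB n t ht).1
    simpa using (hr1 t ht).sub h1
  have hℓM : ∀ t ∈ B, |ℓ t| ≤ M := fun t ht =>
    le_of_tendsto' (hr1 t ht).abs fun n => (hpB (J n t) t ht).1.1
  have hdom : ∀ x : Ω → ℝ, (∀ t ∈ B, |x t| ≤ M) →
      ∀ᵐ t ∂μ, |B.indicator x t| ≤ |ι ((M : ℝ) • e) t| := fun x hx => by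
    filter_upwards [he, IsFunctionSpace.coe_smul (ι := ι) (M : ℝ) e] with t h1 h2
    by_cases ht : t ∈ B
    · rw [h2, h1, Set.indicator_of_mem ht, Set.indicator_of_mem (hBD ht)]
      simpa using hx t ht
    · simp [ht]
  obtain ⟨f, hf⟩ := hι.exists_of_abs_le (hℓm.indicator hBm).aestronglyMeasurable _ (hdom ℓ hℓM)
  have key : ∀ q : ℕ → Ω → ℚ, (∀ n, Measurable (q n)) → (∀ n, ∀ t ∈ B, |(q n t : ℝ)| ≤ M) →
      (∀ t ∈ B, Tendsto (fun n => (q n t : ℝ)) atTop (𝓝 (ℓ t))) →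
      ∃ u : ℕ → X, (∀ n, ∀ᵐ t ∂μ, t ∈ B → h (u n) t = k (q n t) t) ∧
        Tendsto (fun n => ∫ t in B, h (u n) t ∂μ) atTop (𝓝 (∫ t in B, h f t ∂μ)) := by
    intro q hqm hqM hq
    have hqr : ∀ n, Measurable fun t => (q n t : ℝ) := fun n =>
      measurable_from_top.comp (hqm n)
    choose u hu using fun n => hι.exists_of_abs_le
      ((hqr n).indicator hBm).aestronglyMeasurable _ (hdom _ (hqM n))
    refine ⟨u, fun n => ?_, ?_⟩
    · have h0 : Measurable fun t => B.indicator (q n) t := (hqm n).indicator hBm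
      have h1 := hh.ae_eq_of_rat hι hD he (f := u n) h0 (by
        filter_upwards [hu n] with t ht _
        rw [ht]
        by_cases h : t ∈ B <;> simp [h])
      filter_upwards [h1] with t ht htB
      rw [ht (hBD htB), Set.indicator_of_mem htB]
    · refine hh.tendsto_setIntegral hX hι hV ((M : ℝ) • e) (fun n => ?_) ?_ hBm
      · filter_upwards [hu n, hdom _ (hqM n)] with t h1 h2
        rwa [h1]
      · filter_upwards [ae_all_iff.2 hu, hf] with t h1 h2
        simp only [h1, h2]
        by_cases ht : t ∈ B
        · simpa [ht] using hq t ht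
        · simp [ht]
  obtain ⟨u, hu, hulim⟩ := key (fun n t => (r n t).1) (fun n => measurable_fst.comp (hrm n))
    (fun n t ht => (hpB _ t ht).1.1) hr1
  obtain ⟨w, hw, hwlim⟩ := key (fun n t => (r n t).2) (fun n => measurable_snd.comp (hrm n))
    (fun n t ht => (hpB _ t ht).1.2) hr2
  -- The pairs were selected so that the densities differ by more than ε on B, while the two
  -- integrals have a common limit; this forces μ B = 0.
  have hlow : ∀ n, ε * μ.real B ≤ ∫ t in B, h (u n) t ∂μ - ∫ t in B, h (w n) t ∂μ := fun n => by
    have h1 := (hh.integrable (u n)).integrableOn (s := B)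
    have h2 := (hh.integrable (w n)).integrableOn (s := B)
    rw [← integral_sub h1 h2]
    have h3 : ∫ _ in B, ε ∂μ = ε * μ.real B := by simp [mul_comm]
    rw [← h3]
    refine setIntegral_mono_on_ae (integrableOn_const ((measure_mono hBD).trans_lt hμD).ne)
      (h1.sub h2) hBm ?_
    filter_upwards [hu n, hw n] with t h4 h5 ht
    rw [h4 ht, h5 ht]
    exact (hpB (J n t) t ht).2.2.le
  have hlim := hulim.sub hwlim
  rw [sub_self] at hlim
  have h0 : ε * μ.real B ≤ 0 := ge_of_tendsto' hlim hlow
  have h1 : μ.real B = 0 :=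
    le_antisymm (nonpos_of_mul_nonpos_right h0 hε) measureReal_nonneg
  exact (measureReal_eq_zero_iff ((measure_mono hBD).trans_lt hμD).ne).1 h1

/-- K is the continuous extension of q ↦ h(q • 1_D)(t), set to 0 off the good set. For general f,
rational-valued approximations pass to the limit on both sides: set integrals of densities by
continuity of V, and K by continuity in its parameter. -/
theorem exists_kernel_on (hh : IsDensityFamily ι V h)
    (hX : IsOrderContinuousNorm X) (hι : IsFunctionSpace μ ι) (hV : Continuous V)
    {D : Set Ω} (hD : MeasurableSet D) (hμD : μ D < ⊤) :
    ∃ K : ℝ → Ω → ℝ, (∀ l, Measurable (K l)) ∧ (∀ t, Continuous fun l => K l t) ∧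
      ∀ f, ∀ᵐ t ∂μ, t ∈ D → h f t = K (ι f t) t := by
  obtain ⟨e, he⟩ := hι.exists_one_indicator hD hμD
  set k : Ω → ℚ → ℝ := fun t q => h ((q : ℝ) • e) t with hk
  have hgood : ∀ᵐ t ∂μ, t ∈ D → ∀ M j : ℕ, ¬OscillatesBy (k t) M (1 / (j + 1)) := by
    have : ∀ᵐ t ∂μ, ∀ M j : ℕ, t ∈ D → ¬OscillatesBy (k t) M (1 / (j + 1)) :=
      ae_all_iff.2 fun M => ae_all_iff.2 fun j =>
        hh.ae_not_oscillatesBy hX hι hV hD hμD he M Nat.one_div_pos_of_nat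
    filter_upwards [this] with t ht htD M j using ht M j htD
  obtain ⟨N, hNsub, hNm, hN0⟩ := exists_measurable_superset_of_null (ae_iff.1 hgood)
  have hG : ∀ t ∈ D \ N, ∀ x : ℝ,
      ∃ c, Tendsto (k t) (comap (fun q : ℚ => (q : ℝ)) (𝓝 x)) (𝓝 c) := fun t ht =>
    exists_tendsto_of_not_oscillatesBy (by
      by_contra hc
      exact ht.2 (hNsub fun h' => hc (h' ht.1)))
  have hGm : MeasurableSet (D \ N) := hD.diff hNm
  have hde := Rat.isDenseEmbedding_coe_real.isDenseInducing
  set K : ℝ → Ω → ℝ := fun l => (D \ N).indicator fun t => hde.extend (k t) l with hK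
  have hKc : ∀ t, Continuous fun l => K l t := fun t => by
    by_cases ht : t ∈ D \ N
    · simpa only [hK, Set.indicator_of_mem ht] using hde.continuous_extend (hG t ht)
    · simpa only [hK, Set.indicator_of_notMem ht] using continuous_const
  have hKrat : ∀ q : ℚ, K q = (D \ N).indicator fun t => k t q := fun q => by
    ext t
    by_cases ht : t ∈ D \ N
    · simp only [hK, Set.indicator_of_mem ht]
      exact hde.extend_eq' (hG t ht) q
    · simp only [hK, Set.indicator_of_notMem ht]
  -- For real l, `K l` is a pointwise limit of the measurable functions at rational parameters.
  have hKm : ∀ l, Measurable (K l) := fun l => by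
    obtain ⟨x, hx, hxl⟩ := mem_closure_iff_seq_limit.1 (Rat.denseRange_cast (𝕜 := ℝ) l)
    choose q hq using hx
    refine measurable_of_tendsto_metrizable (f := fun n => K (q n)) (fun n => ?_)
      (tendsto_pi_nhds.2 fun t => ?_)
    · rw [hKrat]
      exact (hh.measurable _).indicator hGm
    · refine ((hKc t).tendsto l).comp ?_
      simpa only [hq] using hxl
  refine ⟨K, hKm, hKc, fun f => ?_⟩
  set q : ℕ → Ω → ℚ := fun n t => (⌊ι f t * (n + 1)⌋ : ℚ) / (n + 1) with hq
  have hqm : ∀ n, Measurable (q n) := fun n => by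
    have h1 : Measurable fun t => ⌊ι f t * ((n : ℝ) + 1)⌋ :=
      ((ι f).measurable.mul_const _).floor
    exact (measurable_from_top (f := fun z : ℤ => (z : ℚ) / (n + 1))).comp h1
  have hqf : ∀ n t, |(q n t : ℝ) - ι f t| ≤ 1 / ((n : ℝ) + 1) := fun n t => by
    have hn : (0 : ℝ) < (n : ℝ) + 1 := by positivity
    have h1 := Int.floor_le (ι f t * ((n : ℝ) + 1))
    have h2 := Int.lt_floor_add_one (ι f t * ((n : ℝ) + 1))
    have h3 : (q n t : ℝ) - ι f t = (⌊ι f t * ((n : ℝ) + 1)⌋ - ι f t * (n + 1)) / (n + 1) := by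
      simp only [hq]
      push_cast
      field_simp
    rw [h3, abs_div, abs_of_pos hn]
    gcongr
    rw [abs_le]
    exact ⟨by linarith, by linarith⟩
  have hlimq : ∀ t, Tendsto (fun n => (q n t : ℝ)) atTop (𝓝 (ι f t)) := fun t => by
    rw [tendsto_iff_norm_sub_tendsto_zero]
    exact squeeze_zero (fun _ => norm_nonneg _) (fun n => hqf n t)
      tendsto_one_div_add_atTop_nhds_zero_nat
  have hqr : ∀ n, Measurable fun t => (q n t : ℝ) := fun n => measurable_from_top.comp (hqm n)
  -- The rounding error is at most 1, which `e` = 1_D absorbs on D.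
  have hdom : ∀ n, ∀ᵐ t ∂μ, |D.indicator (fun t => (q n t : ℝ)) t| ≤ |ι (|f| + e) t| := fun n => by
    filter_upwards [he, hι.coe_abs f, IsFunctionSpace.coe_add (ι := ι) |f| e] with t h1 h2 h3
    by_cases ht : t ∈ D
    · rw [h3, h2, h1, Set.indicator_of_mem ht, Set.indicator_of_mem ht]
      refine le_trans ?_ (le_abs_self _)
      have h4 : |(q n t : ℝ)| ≤ |ι f t| + |(q n t : ℝ) - ι f t| := by
        simpa using abs_add_le (ι f t) ((q n t : ℝ) - ι f t)
      have h5 : (1 : ℝ) / (n + 1) ≤ 1 := by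
        rw [div_le_one (by positivity)]
        linarith [(Nat.cast_nonneg n : (0 : ℝ) ≤ n)]
      linarith [hqf n t]
    · simp [ht]
  choose u hu using fun n => hι.exists_of_abs_le ((hqr n).indicator hD).aestronglyMeasurable _
    (hdom n)
  obtain ⟨f', hf'⟩ := hι.exists_indicator f hD
  have hff' : ∀ᵐ t ∂μ, t ∈ D → h f t = h f' t := hh.ae_eq_of_ae_eq_on hι hD (by
    filter_upwards [hf'] with t h1 ht
    rw [h1, Set.indicator_of_mem ht])
  have hukq : ∀ᵐ t ∂μ, ∀ n, t ∈ D → h (u n) t = k t (q n t) := ae_all_iff.2 fun n =>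
    hh.ae_eq_of_rat hι hD he (hqm n) (by
      filter_upwards [hu n] with t h1 ht
      rw [h1, Set.indicator_of_mem ht])
  have hfin : IsFiniteMeasure (μ.restrict D) := ⟨by simpa using hμD⟩
  have hmain : ∀ᵐ t ∂μ.restrict D, h f' t = K (ι f t) t := by
    refine ae_eq_of_tendsto_setIntegral (fun n => hh.measurable (u n))
      (hh.integrable f').restrict ?_ fun A hA => ?_
    · rw [ae_restrict_iff' hD]
      filter_upwards [hukq, measure_eq_zero_iff_ae_notMem.1 hN0] with t h1 h2 ht
      refine (((hKc t).tendsto _).comp (hlimq t)).congr fun n => ?_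
      rw [h1 n ht, Function.comp, hKrat, Set.indicator_of_mem (show t ∈ D \ N from ⟨ht, h2⟩)]
    · rw [Measure.restrict_restrict hA]
      refine hh.tendsto_setIntegral hX hι hV (|f| + e) (fun n => ?_) ?_ (hA.inter hD)
      · filter_upwards [hu n, hdom n] with t h1 h2
        rwa [h1]
      · filter_upwards [ae_all_iff.2 hu, hf'] with t h1 h2
        simp only [h1, h2]
        by_cases ht : t ∈ D
        · simpa [ht] using hlimq t
        · simp [ht]
  rw [ae_restrict_iff' hD] at hmain
  filter_upwards [hmain, hff'] with t h1 h2 ht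
  rw [h2 ht, h1 ht]

/-- At each t the kernel of the first spanning set containing t is used; the index is measurable
with countably many values. -/
theorem exists_kernel [SigmaFinite μ] (hh : IsDensityFamily ι V h)
    (hX : IsOrderContinuousNorm X) (hι : IsFunctionSpace μ ι) (hV : Continuous V) :
    ∃ K : ℝ → Ω → ℝ, IsStrongCaratheodory μ K ∧ ∀ f, ∀ᵐ t ∂μ, h f t = K (ι f t) t := by
  choose K hKm hKc hK using fun n => hh.exists_kernel_on hX hι hV
    (measurableSet_spanningSets μ n) (measure_spanningSets_lt_top μ n)
  refine ⟨fun l t => K (spanningSetsIndex μ t) l t, ⟨fun l => ?_, ae_of_all _ fun t => hKc _ t⟩,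
    fun f => ?_⟩
  · have h1 : Measurable fun s : ℕ × Ω => K s.1 l s.2 :=
      measurable_from_prod_countable_right fun n => hKm n l
    exact h1.comp ((measurableSet_spanningSetsIndex μ).prodMk measurable_id)
  · filter_upwards [ae_all_iff.2 fun n => hK n f] with t ht
    exact ht _ (mem_spanningSetsIndex μ t)

end IsDensityFamily

theorem theoremt {Ω : Type*} [MeasurableSpace Ω] (μ : Measure Ω) [SigmaFinite μ]
    {X : Type*} [NormedAddCommGroup X] [NormedSpace ℝ X] [CompleteSpace X]
    [Lattice X] [IsOrderedAddMonoid X] [PosSMulMono ℝ X] [HasSolidNorm X]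
    (hX : IsOrderContinuousNorm X)
    (ι : X →ₗ[ℝ] (Ω →ₘ[μ] ℝ)) (hι : IsFunctionSpace μ ι) :
    (∀ V : X → ℝ, IsContinuousValuation V →
      ∃ K : ℝ → Ω → ℝ, IsStrongCaratheodory μ K ∧
        ∀ f : X, Integrable (fun t => K ((ι f) t) t) μ ∧ V f = ∫ t, K ((ι f) t) t ∂μ) ∧
    (∀ K : ℝ → Ω → ℝ, IsStrongCaratheodory μ K →
      (∀ f : X, Integrable (fun t => K ((ι f) t) t) μ) →
      ∀ V : X → ℝ, (∀ f : X, V f = ∫ t, K ((ι f) t) t ∂μ) →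
        (∀ f g : X, V f + V g = V (f ⊔ g) + V (f ⊓ g)) ∧ Continuous V ∧
        (IsContinuousValuation V ↔ ∫ t, K 0 t ∂μ = 0)) := by
  refine ⟨fun V hV => ?_, fun K hK hint V hVK => ?_⟩
  · obtain ⟨h, hh⟩ := hι.exists_densityFamily hX hV
    obtain ⟨K, hK, hhK⟩ := hh.exists_kernel hX hι hV.continuous
    refine ⟨K, hK, fun f => ⟨(hh.integrable f).congr (hhK f), ?_⟩⟩
    rw [hh.eq_integral f]
    exact integral_congr_ae (hhK f)
  · obtain rfl : V = fun f => ∫ t, K (ι f t) t ∂μ := funext hVK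
    have h1 := hι.integral_comp_add_eq hint
    have h2 := hι.continuous_integral_comp hK.continuous hint
    have h3 : ∫ t, K (ι 0 t) t ∂μ = ∫ t, K 0 t ∂μ := integral_congr_ae (by
      filter_upwards [IsFunctionSpace.coe_zero (ι := ι)] with t ht
      rw [ht])
    exact ⟨h1, h2, fun hV => h3.symm.trans hV.map_zero, fun h0 => ⟨h1, h2, h3.trans h0⟩⟩
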